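/- Let $\tau\in\mathbb C$ with $\operatorname{Im}\tau>0$, $\Lambda=\mathbb Z+\tau\mathbb Z$, $q=e^{i\pi\tau}$, and let $\theta(z)=i\sum_{n\in\mathbb Z}(-1)^nq^{(n-1/2)^2}e^{i\pi(2n-1)z}$ be the odd Jacobi theta function. Fix $\mu\in\mathbb C\setminus\{0\}$ and $\eta\in\mathbb C\setminus\{0\}$. For $k\ge 1$ let $V_k(\mu)$ be the complex vector space of meromorphic functions $g$ on $\mathbb C$ such that $g(z+1)=g(z)$, $g(z+\tau)=\mu^kg(z)$, and $g(z)\prod_{\ell=0}^{k-1}\theta(2z+2\ell\eta)$ is holomorphic on $\mathbb C$. (Thus $V_1(\mu)$ does not depend on $\eta$; its elements have at most simple poles, all in $\Lambda/2$.) For $f\in V_1(\mu)$ let $A(f)=f(z)\exp(\eta\partial_z)+f(-z)\exp(-\eta\partial_z)$, acting on meromorphic functions, where $(\exp(s\partial_z)F)(z)=F(z+s)$. Let $\mathcal V_2(\mu)$ be the linear span of the products $A(f)A(g)$ with $f,g\in V_1(\mu)$. **Lemma 3.3.** (a) The constants (the scalar multiples of the identity operator) form a subspace of $\mathcal V_2(\mu)$.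 (b) For every $c_2\in V_2(\mu)$ there is an even elliptic function $c_0$ (with period lattice $\Lambda$) such that the operator $$c_2(z)\exp(2\eta\partial_z)+c_0(z)+c_2(-z)\exp(-2\eta\partial_z)$$ belongs to $\mathcal V_2(\mu)$. (c) $V_2(\mu)$ is the linear span of the products $f(z)g(z+\eta)$ with $f,g\in V_1(\mu)$. All of this holds for every $\eta\neq 0$, including $\eta\in\Lambda/4$. -/

import Mathlib

open Filter Complex Topology

noncomputable section

namespace SklyaninOps

/-! ### Meromorphic functions on the complex plane

A meromorphic function is a function `ℂ → ℂ` that is meromorphic at every point, where two such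
functions are identified if they agree off a closed discrete set (so that values taken at poles
are irrelevant). -/

/-- The germs along `codiscrete ℂ`, i.e. the classes of functions modulo equality off a closed
discrete set, form a `ℂ`-algebra. -/
instance instAlgebraGerm : Algebra ℂ (Germ (codiscrete ℂ) ℂ) :=
  Algebra.ofModule
    (fun r x y => by
      induction x using Germ.inductionOn with | _ f =>
      induction y using Germ.inductionOn with | _ g =>
      rw [← Germ.coe_smul, ← Germ.coe_mul, ← Germ.coe_mul, ← Germ.coe_smul, smul_mul_assoc])
    (fun r x y => by
      induction x using Germ.inductionOn with | _ f =>
      induction y using Germ.inductionOn with | _ g =>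
      rw [← Germ.coe_smul, ← Germ.coe_mul, ← Germ.coe_mul, ← Germ.coe_smul, mul_smul_comm])

/-- The `ℂ`-algebra of meromorphic functions on `ℂ`. -/
def merSubalgebra : Subalgebra ℂ (Germ (codiscrete ℂ) ℂ) where
  carrier := {g | ∃ f : ℂ → ℂ, Meromorphic f ∧ g = (f : Germ (codiscrete ℂ) ℂ)}
  mul_mem' := by
    rintro _ _ ⟨f, hf, rfl⟩ ⟨g, hg, rfl⟩
    exact ⟨f * g, hf.mul hg, rfl⟩
  add_mem' := by
    rintro _ _ ⟨f, hf, rfl⟩ ⟨g, hg, rfl⟩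
    exact ⟨f + g, hf.add hg, rfl⟩
  algebraMap_mem' := fun r =>
    ⟨r • (1 : ℂ → ℂ), (Meromorphic.const (1 : ℂ)).const_smul r, by
      rw [Algebra.algebraMap_eq_smul_one]; rfl⟩

/-- The type of meromorphic functions on `ℂ`. -/
abbrev Mer : Type := merSubalgebra

/-- The change of variable `z ↦ ε z + s` with `ε ≠ 0` pulls complements of closed discrete sets
back to complements of closed discrete sets. -/
lemma tendsto_affine_codiscrete (ε s : ℂ) (hε : ε ≠ 0) :
    Tendsto (fun z : ℂ => ε * z + s) (codiscrete ℂ) (codiscrete ℂ) := by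
  intro T hT
  simp only [mem_map, codiscrete, mem_codiscreteWithin_iff_forall_mem_nhdsNE, Set.mem_univ,
    forall_const, Set.compl_univ, Set.union_empty] at hT ⊢
  intro x
  have hinj : Function.Injective (fun z : ℂ => ε * z + s) := fun a b h => by
    simpa [hε] using h
  have hc : ContinuousAt (fun z : ℂ => ε * z + s) x := by fun_prop
  exact (hc.continuousWithinAt.tendsto_nhdsWithin
    (fun y (hy : y ≠ x) => hinj.ne hy) : Tendsto _ (𝓝[≠] x) (𝓝[≠] _)) (hT _)

/-- The substitution operator `f(z) ↦ f(ε z + s)` on meromorphic functions, for `ε ≠ 0`. -/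
def affineSubst (ε s : ℂ) (hε : ε ≠ 0) : Mer →ₗ[ℂ] Mer where
  toFun f := ⟨(f : Germ (codiscrete ℂ) ℂ).compTendsto (fun z : ℂ => ε * z + s)
      (tendsto_affine_codiscrete ε s hε), by
    obtain ⟨_, f, hf, rfl⟩ := f
    exact ⟨f ∘ fun z => ε * z + s,
      fun x => (hf _).comp_analyticAt (g := fun z => ε * z + s) (by fun_prop), rfl⟩⟩
  map_add' f g := by
    obtain ⟨_, f, hf, rfl⟩ := f
    obtain ⟨_, g, hg, rfl⟩ := g
    rfl
  map_smul' c f := by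
    obtain ⟨_, f, hf, rfl⟩ := f
    rfl

/-- The shift `exp(s ∂_z)`, that is `(exp(s ∂_z) f)(z) = f(z + s)`. -/
def shift (s : ℂ) : Module.End ℂ Mer := affineSubst 1 s one_ne_zero

/-- The reflection `f(z) ↦ f(-z)`. -/
def reflect : Module.End ℂ Mer := affineSubst (-1) 0 (neg_ne_zero.mpr one_ne_zero)

/-- The operator of multiplication by a meromorphic function. -/
def mulOp (f : Mer) : Module.End ℂ Mer := LinearMap.mulLeft ℂ f

/-! ### Theta functions and the coefficient spaces -/

/-- The odd Jacobi theta function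
`θ(z) = i ∑_{n ∈ ℤ} (-1)^n q^{(n-1/2)^2} exp(iπ(2n-1)z)`, `q = exp(iπτ)`. -/
def theta (τ z : ℂ) : ℂ :=
  I * ∑' n : ℤ, (-1 : ℂ) ^ n * cexp (I * Real.pi * τ * ((n : ℂ) - 1 / 2) ^ 2) *
    cexp (I * Real.pi * (2 * (n : ℂ) - 1) * z)

/-- `P_k(η, z) = ∏_{ℓ=0}^{k-1} θ(2z + 2ℓη)`. -/
def thetaProd (τ η : ℂ) (k : ℕ) (z : ℂ) : ℂ :=
  ∏ l ∈ Finset.range k, theta τ (2 * z + 2 * (l : ℂ) * η)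

/-- The space `V_k(μ)` of meromorphic functions `g` with `g(z + 1) = g(z)`,
`g(z + τ) = μ^k g(z)` and `g(z) P_k(η, z)` holomorphic on `ℂ`. For `k = 1` it does not depend
on `η`, since `P_1(η, z) = θ(2z)`. -/
def coeffSpace (τ η μ : ℂ) (k : ℕ) : Submodule ℂ Mer where
  carrier := {g | shift 1 g = g ∧ shift τ g = μ ^ k • g ∧
    ∃ h : ℂ → ℂ, Differentiable ℂ h ∧
      (g : Germ (codiscrete ℂ) ℂ) * (thetaProd τ η k : Germ (codiscrete ℂ) ℂ) =
        (h : Germ (codiscrete ℂ) ℂ)}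
  zero_mem' := ⟨map_zero _, by rw [map_zero, smul_zero], 0, differentiable_zero, zero_mul _⟩
  add_mem' := by
    rintro f g ⟨hf₁, hf₂, u, hu, hf₃⟩ ⟨hg₁, hg₂, v, hv, hg₃⟩
    refine ⟨by rw [map_add, hf₁, hg₁], by rw [map_add, hf₂, hg₂, smul_add], u + v, hu.add hv, ?_⟩
    rw [Subalgebra.coe_add, add_mul, hf₃, hg₃, Germ.coe_add]
  smul_mem' := by
    rintro c g ⟨hg₁, hg₂, v, hv, hg₃⟩
    refine ⟨by rw [map_smul, hg₁], by rw [map_smul, hg₂, smul_comm], c • v, hv.const_smul c, ?_⟩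
    rw [Subalgebra.coe_smul, smul_mul_assoc, hg₃, Germ.coe_smul]

/-! ### The difference operators -/

/-- The generator `A(f) = f(z) exp(η ∂_z) + f(-z) exp(-η ∂_z)`, acting on meromorphic
functions. -/
def genOp (η : ℂ) (f : Mer) : Module.End ℂ Mer :=
  mulOp f * shift η + mulOp (reflect f) * shift (-η)

/-- The span of the twofold products (compositions) `A(f) A(g)` with `f, g ∈ V_1(μ)`. -/
def twofoldSpan (τ η μ : ℂ) : Submodule ℂ (Module.End ℂ Mer) :=
  Submodule.span ℂ {T | ∃ f ∈ coeffSpace τ η μ 1, ∃ g ∈ coeffSpace τ η μ 1,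
    T = genOp η f * genOp η g}

end SklyaninOps

end

open SklyaninOps

namespace SklyaninOps

/-! ### Fourier coefficients of entire periodic functions -/

/-! Write `μ = exp(4πi c)`. For `u` in `thetaFour τ` the quotient `u(2z - c) / θ(2z)` lies in
`V_1(μ)`. Clearing denominators in `V_2(μ)` and putting `x = 2z - c + η` turns (c) into a statement
on entire functions: every theta function of degree eight (in `x / 2`) is a combination of products
`u(x + t) v(x - t)` with `u, v` of degree four, for every `t` (`mem_shiftedProducts`). Translation
by `1` and a twisted translation by `τ` are commuting involutions on the degree eight functions.
They split such a function into four pieces with signs `(ε, δ)`, and quarter-period translations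
carry each piece into `degreeTwo τ`, spanned by `evenTheta` and `oddTheta`. The addition formulas
express `θ_ab(x + t) θ_ab(x - t)` through these two functions of `x`, with coefficients given by
their values at `t`. Since those values never vanish simultaneously, both basis functions are
recovered for every `t`; this is why torsion values of `η` cause no trouble. In `A(f) A(g)` the
coefficient of `exp(2η∂)` is `f(z) g(z + η)` and the constant coefficient is even and elliptic, so
(b) follows from (c) by linearity. For (a), the addition formulas yield a combination of the squares
`A(f_i)²`, with `f_i` from the four theta functions with characteristics, whose outer coefficients
cancel and whose constant coefficient is 2 (`exists_coeffs_sum_theta`). -/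

lemma integral_add_eq_of_periodic {H : ℂ → ℂ} (hd : Differentiable ℂ H)
    (hp : ∀ z, H (z + 1) = H z) (w : ℂ) :
    ∫ x in (0 : ℝ)..1, H (x + w) = ∫ x in (0 : ℝ)..1, H x := by
  have hreal : ∫ x in (0 : ℝ)..1, H (x + w) = ∫ x in (0 : ℝ)..1, H (x + w.im * I) := by
    have h1 : ∫ x in (0 : ℝ)..1, H (x + w) = ∫ x in (0 : ℝ)..1,
        (fun y : ℝ => H (y + w.im * I)) (x + w.re) := by
      refine intervalIntegral.integral_congr fun x _ => ?_
      simp only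
      congr 1
      conv_lhs => rw [← re_add_im w]
      push_cast; ring
    rw [h1, intervalIntegral.integral_comp_add_right (fun y : ℝ => H (y + w.im * I))]
    have hper : Function.Periodic (fun y : ℝ => H (y + w.im * I)) 1 := fun y => by
      simp only
      rw [← hp (y + w.im * I)]
      congr 1
      push_cast; ring
    have := hper.intervalIntegral_add_eq w.re 0
    simpa [add_comm] using this
  rw [hreal]
  -- Cauchy's theorem on the rectangle of width one; its vertical sides cancel by periodicity.
  have := integral_boundary_rect_eq_zero_of_differentiableOn H 0 (1 + w.im * I)
    hd.differentiableOn
  simp only [zero_re, zero_im, add_re, one_re, mul_re, ofReal_re, I_re, mul_zero, ofReal_im, I_im,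
    mul_one, sub_self, add_zero, add_im, one_im, mul_im, zero_add, ofReal_zero, zero_mul,
    ofReal_one] at this
  have hside : ∫ y in (0 : ℝ)..w.im, H (1 + y * I) = ∫ y in (0 : ℝ)..w.im, H (y * I) :=
    intervalIntegral.integral_congr fun y _ => by
      rw [add_comm, hp]
  rw [hside] at this
  linear_combination -this

/-- The Fourier series on the real line is trivially summable, so it represents `H` there; the
identity theorem does the rest. -/
lemma eq_zero_of_fourier_eq_zero {H : ℂ → ℂ} (hd : Differentiable ℂ H)
    (hp : ∀ z, H (z + 1) = H z)
    (h0 : ∀ n : ℤ, ∫ x in (0 : ℝ)..1, cexp (-(2 * Real.pi * I * n * x)) * H x = 0) :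
    H = 0 := by
  have hper : Function.Periodic (fun y : ℝ => H y) 1 := fun y => by
    simp only
    rw [← hp y]
    push_cast; rfl
  have : Fact ((0 : ℝ) < 1) := ⟨one_pos⟩
  let F : C(AddCircle (1 : ℝ), ℂ) := ⟨hper.lift, by
    refine continuous_coinduced_dom.mpr ?_
    exact hd.continuous.comp continuous_ofReal⟩
  have hc : ∀ n, fourierCoeff F n = 0 := fun n => by
    rw [fourierCoeff_eq_intervalIntegral _ n 0]
    simp only [zero_add, div_one, one_smul]
    rw [← h0 n]
    refine intervalIntegral.integral_congr fun x _ => ?_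
    simp only [smul_eq_mul, fourier_coe_apply]
    congr 2
    push_cast; ring
  have hs : Summable (fourierCoeff F) := by
    rw [show fourierCoeff F = fun _ => 0 from funext hc]
    exact summable_zero
  have hz : ∀ x : ℝ, H x = 0 := fun x => by
    have := has_pointwise_sum_fourier_series_of_summable hs (x : AddCircle (1 : ℝ))
    simp only [hc, zero_smul] at this
    exact this.unique hasSum_zero
  have han : AnalyticOnNhd ℂ H Set.univ := fun z _ => hd.analyticAt z
  refine han.eq_of_frequently_eq (z₀ := 0) (fun z _ => analyticAt_const) ?_
  have ht : Tendsto (fun x : ℝ => (x : ℂ)) (𝓝[≠] 0) (𝓝[≠] 0) := by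
    have : ContinuousAt (fun x : ℝ => (x : ℂ)) 0 := by fun_prop
    simpa using this.continuousWithinAt.tendsto_nhdsWithin (s := {0}ᶜ) (t := {0}ᶜ)
      (fun x hx => by simpa using hx)
  exact ht.frequently (Frequently.of_forall fun x => by simpa using hz x)

/-- The zeroth Fourier coefficient, computed termwise, is 1. -/
lemma exists_jacobiTheta₂_ne_zero {τ : ℂ} (hτ : 0 < τ.im) : ∃ z, jacobiTheta₂ z τ ≠ 0 := by
  by_contra! h
  have hs : HasSum (fun n : ℤ => ∫ x in (0 : ℝ)..1, jacobiTheta₂_term n x τ)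
      (∫ x in (0 : ℝ)..1, ∑' n : ℤ, jacobiTheta₂_term n x τ) := by
    let F : ℤ → C(ℝ, ℂ) := fun n => ⟨fun x => jacobiTheta₂_term n x τ, by
      unfold jacobiTheta₂_term; fun_prop⟩
    refine intervalIntegral.hasSum_intervalIntegral_of_summable_norm (f := F) ?_
    have h0 := ((summable_jacobiTheta₂_term_iff 0 τ).mpr hτ).norm
    refine h0.of_nonneg_of_le (fun _ => norm_nonneg _) fun n => ?_
    rw [ContinuousMap.norm_le _ (norm_nonneg _)]
    intro x
    change ‖jacobiTheta₂_term n (x : ℝ) τ‖ ≤ _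
    rw [norm_jacobiTheta₂_term, norm_jacobiTheta₂_term]
    simp
  have h1 : ∫ x in (0 : ℝ)..1, ∑' n : ℤ, jacobiTheta₂_term n x τ = 0 := by
    have : ∀ x : ℝ, ∑' n : ℤ, jacobiTheta₂_term n x τ = 0 := fun x => h x
    simp [this]
  rw [h1] at hs
  have h2 : HasSum (fun n : ℤ => ∫ x in (0 : ℝ)..1, jacobiTheta₂_term n x τ) 1 := by
    have h3 : ∀ n : ℤ, n ≠ 0 → ∫ x in (0 : ℝ)..1, jacobiTheta₂_term n x τ = 0 := fun n hn => by
      have hne : 2 * Real.pi * I * n ≠ 0 := by simp [hn, Real.pi_ne_zero]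
      simp only [jacobiTheta₂_term, Complex.exp_add]
      rw [intervalIntegral.integral_mul_const, integral_exp_mul_complex hne]
      have : cexp (2 * Real.pi * I * n) = 1 := by
        rw [mul_comm]; exact exp_int_mul_two_pi_mul_I n
      simp [this]
    have h4 := hasSum_single 0 h3
    simpa [jacobiTheta₂_term] using h4
  exact one_ne_zero (h2.unique hs)

end SklyaninOps

namespace SklyaninOps

/-! ### Theta functions of degree two and four -/

lemma exp_eq_neg_exp {a b : ℂ} (h : a = b + Real.pi * I) : cexp a = -cexp b := by
  rw [h, Complex.exp_add, exp_pi_mul_I, mul_neg_one]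

lemma exp_eq_exp {a b : ℂ} (h : a = b + 2 * Real.pi * I) : cexp a = cexp b := by
  rw [h, Complex.exp_add, exp_two_pi_mul_I, mul_one]

lemma differentiable_jacobiTheta₂ {τ : ℂ} (hτ : 0 < τ.im) :
    Differentiable ℂ fun z => jacobiTheta₂ z τ :=
  fun z => differentiableAt_jacobiTheta₂_fst z hτ

/-- The theta function of degree two with even Fourier exponents. -/
noncomputable def evenTheta (τ x : ℂ) : ℂ := jacobiTheta₂ (2 * x) (2 * τ)

/-- The theta function of degree two with odd Fourier exponents. -/
noncomputable def oddTheta (τ x : ℂ) : ℂ :=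
  cexp (Real.pi * I * τ / 2 + 2 * Real.pi * I * x) * jacobiTheta₂ (2 * x + τ) (2 * τ)

lemma two_mul_im_pos {τ : ℂ} (hτ : 0 < τ.im) : 0 < (2 * τ).im := by simpa using hτ

lemma hasSum_jacobiTheta₂_term_mul (z w : ℂ) (σ : ℂ) (hσ : 0 < σ.im) : HasSum
    (fun p : ℤ × ℤ => jacobiTheta₂_term p.1 z σ * jacobiTheta₂_term p.2 w σ)
    (jacobiTheta₂ z σ * jacobiTheta₂ w σ) := by
  have hs := summable_mul_of_summable_norm ((summable_jacobiTheta₂_term_iff z σ).mpr hσ).norm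
    ((summable_jacobiTheta₂_term_iff w σ).mpr hσ).norm
  exact HasSum.mul (f := fun n => jacobiTheta₂_term n z σ) (g := fun n => jacobiTheta₂_term n w σ)
    (hasSum_jacobiTheta₂_term z hσ) (hasSum_jacobiTheta₂_term w hσ) hs

/-- The double series over `(n, m)` is split by the parity of `n + m`. With `n = k + l`, `m = k - l`
one has `n² + m² = 2k² + 2l²`, so each half factors into series with modulus `2τ`; in the odd half
`k` and `l` become half-integers. -/
lemma jacobiTheta₂_add_mul_sub {τ : ℂ} (hτ : 0 < τ.im) (x y : ℂ) :
    jacobiTheta₂ (x + y) τ * jacobiTheta₂ (x - y) τ =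
      evenTheta τ x * evenTheta τ y + oddTheta τ x * oddTheta τ y := by
  let e : ℤ × ℤ → ℤ × ℤ := fun p => (p.1 + p.2, p.1 - p.2)
  let o : ℤ × ℤ → ℤ × ℤ := fun p => (p.1 + p.2 + 1, p.1 - p.2)
  have he : Function.Injective e := fun p q h => by
    simp only [e, Prod.mk.injEq] at h
    ext <;> omega
  have ho : Function.Injective o := fun p q h => by
    simp only [o, Prod.mk.injEq] at h
    ext <;> omega
  have hcompl : IsCompl (Set.range e) (Set.range o) := by
    refine ⟨Set.disjoint_iff_forall_ne.mpr ?_, codisjoint_iff.mpr ?_⟩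
    · rintro _ ⟨a, rfl⟩ _ ⟨b, rfl⟩ h
      simp only [e, o, Prod.mk.injEq] at h
      omega
    · refine Set.eq_univ_of_forall fun ⟨n, m⟩ => ?_
      rcases Int.even_or_odd' (n + m) with ⟨k, hk | hk⟩
      · exact Or.inl ⟨(k, k - m), by simp only [e, Prod.mk.injEq]; omega⟩
      · exact Or.inr ⟨(k, k - m), by simp only [o, Prod.mk.injEq]; omega⟩
  have hE := hasSum_jacobiTheta₂_term_mul (2 * x) (2 * y) (2 * τ) (two_mul_im_pos hτ)
  have hO := (hasSum_jacobiTheta₂_term_mul (2 * x + τ) (2 * y + τ) (2 * τ) (two_mul_im_pos hτ)).mul_left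
    (cexp (Real.pi * I * τ / 2 + 2 * Real.pi * I * x) *
      cexp (Real.pi * I * τ / 2 + 2 * Real.pi * I * y))
  set f : ℤ × ℤ → ℂ := fun p => jacobiTheta₂_term p.1 (x + y) τ * jacobiTheta₂_term p.2 (x - y) τ
  have hE' : HasSum (f ∘ ((↑) : Set.range e → ℤ × ℤ)) (evenTheta τ x * evenTheta τ y) := by
    refine he.hasSum_range_iff.mpr ?_
    convert! hE using 1
    ext p
    simp only [Function.comp, f, e, jacobiTheta₂_term, ← Complex.exp_add]
    congr 1
    push_cast; ring
  have hO' : HasSum (f ∘ ((↑) : Set.range o → ℤ × ℤ)) (oddTheta τ x * oddTheta τ y) := by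
    refine ho.hasSum_range_iff.mpr ?_
    convert! hO using 1
    · ext p
      simp only [Function.comp, f, o, jacobiTheta₂_term, ← Complex.exp_add]
      congr 1
      push_cast; ring
    · unfold oddTheta; ring
  exact (hasSum_jacobiTheta₂_term_mul (x + y) (x - y) τ hτ).unique (hE'.add_isCompl hcompl hO')

/-! ### Half-period and period translations of `evenTheta` and `oddTheta`. -/

section Translation

variable (τ x : ℂ)

lemma evenTheta_add_half : evenTheta τ (x + 1 / 2) = evenTheta τ x := by
  unfold evenTheta
  rw [← jacobiTheta₂_add_left (2 * x)]
  congr 1; ring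

lemma oddTheta_add_half : oddTheta τ (x + 1 / 2) = -oddTheta τ x := by
  unfold oddTheta
  rw [show 2 * (x + 1 / 2) + τ = 2 * x + τ + 1 by ring, jacobiTheta₂_add_left,
    exp_eq_neg_exp (b := Real.pi * I * τ / 2 + 2 * Real.pi * I * x) (by ring)]
  ring

lemma evenTheta_add_half_tau :
    cexp (Real.pi * I * τ / 2 + 2 * Real.pi * I * x) * evenTheta τ (x + τ / 2) =
      oddTheta τ x := by
  unfold evenTheta oddTheta
  congr 2; ring

lemma oddTheta_add_half_tau :
    cexp (Real.pi * I * τ / 2 + 2 * Real.pi * I * x) * oddTheta τ (x + τ / 2) =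
      evenTheta τ x := by
  unfold evenTheta oddTheta
  rw [show 2 * (x + τ / 2) + τ = 2 * x + 2 * τ by ring, jacobiTheta₂_add_left', ← mul_assoc,
    ← mul_assoc, ← Complex.exp_add, ← Complex.exp_add]
  ring_nf
  simp

lemma evenTheta_add_one : evenTheta τ (x + 1) = evenTheta τ x := by
  rw [show x + 1 = x + 1 / 2 + 1 / 2 by ring, evenTheta_add_half, evenTheta_add_half]

lemma oddTheta_add_one : oddTheta τ (x + 1) = oddTheta τ x := by
  rw [show x + 1 = x + 1 / 2 + 1 / 2 by ring, oddTheta_add_half, oddTheta_add_half, neg_neg]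

lemma evenTheta_add_tau :
    cexp (2 * Real.pi * I * τ + 4 * Real.pi * I * x) * evenTheta τ (x + τ) = evenTheta τ x := by
  rw [← oddTheta_add_half_tau τ x, ← evenTheta_add_half_tau τ (x + τ / 2), ← mul_assoc,
    ← Complex.exp_add]
  ring_nf

lemma oddTheta_add_tau :
    cexp (2 * Real.pi * I * τ + 4 * Real.pi * I * x) * oddTheta τ (x + τ) = oddTheta τ x := by
  rw [← evenTheta_add_half_tau τ x, ← oddTheta_add_half_tau τ (x + τ / 2), ← mul_assoc,
    ← Complex.exp_add]
  ring_nf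

end Translation

lemma differentiable_evenTheta {τ : ℂ} (hτ : 0 < τ.im) : Differentiable ℂ (evenTheta τ) :=
  (differentiable_jacobiTheta₂ (two_mul_im_pos hτ)).comp (differentiable_id.const_mul 2)

lemma differentiable_oddTheta {τ : ℂ} (hτ : 0 < τ.im) : Differentiable ℂ (oddTheta τ) := by
  have := (differentiable_jacobiTheta₂ (two_mul_im_pos hτ)).comp
    ((differentiable_id.const_mul (2 : ℂ)).add_const τ)
  exact Differentiable.mul (by fun_prop) this

/-- Entire functions with the quasi-periodicity of a theta function of degree four in `x / 2`. -/
noncomputable def thetaFour (τ : ℂ) : Submodule ℂ (ℂ → ℂ) where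
  carrier := {u | Differentiable ℂ u ∧ (∀ x, u (x + 2) = u x) ∧
    ∀ x, u (x + 2 * τ) = cexp (-(4 * Real.pi * I * (x + τ))) * u x}
  zero_mem' := ⟨differentiable_const 0, by simp, by simp⟩
  add_mem' := by
    rintro u v ⟨hu, hu₁, hu₂⟩ ⟨hv, hv₁, hv₂⟩
    refine ⟨hu.add hv, fun x => ?_, fun x => ?_⟩
    · simp [hu₁, hv₁]
    · simp [hu₂, hv₂, mul_add]
  smul_mem' := by
    rintro c u ⟨hu, hu₁, hu₂⟩
    refine ⟨hu.const_smul c, fun x => ?_, fun x => ?_⟩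
    · simp [hu₁]
    · simp [hu₂, mul_left_comm]

lemma jacobiTheta₂_mem_thetaFour {τ : ℂ} (hτ : 0 < τ.im) :
    (fun x => jacobiTheta₂ x τ) ∈ thetaFour τ := by
  refine ⟨differentiable_jacobiTheta₂ hτ, fun x => ?_, fun x => ?_⟩
  · simp only
    rw [show x + 2 = x + 1 + 1 by ring, jacobiTheta₂_add_left, jacobiTheta₂_add_left]
  · simp only
    rw [show x + 2 * τ = x + τ + τ by ring, jacobiTheta₂_add_left', jacobiTheta₂_add_left',
      ← mul_assoc, ← Complex.exp_add]
    ring_nf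

lemma comp_add_half_mem_thetaFour {τ : ℂ} {u : ℂ → ℂ} (hu : u ∈ thetaFour τ) :
    (fun x => u (x + 1 / 2)) ∈ thetaFour τ := by
  obtain ⟨hd, h₁, h₂⟩ := hu
  refine ⟨by fun_prop, fun x => ?_, fun x => ?_⟩
  · simp only
    rw [← h₁ (x + 1 / 2)]; congr 1; ring
  · simp only
    rw [show x + 2 * τ + 1 / 2 = x + 1 / 2 + 2 * τ by ring, h₂,
      ← exp_eq_exp (a := -(4 * Real.pi * I * (x + τ)))
        (b := -(4 * Real.pi * I * (x + 1 / 2 + τ))) (by ring)]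

lemma exp_mul_comp_add_half_tau_mem_thetaFour {τ : ℂ} {u : ℂ → ℂ} (hu : u ∈ thetaFour τ) :
    (fun x => cexp (Real.pi * I * (τ / 4 + x)) * u (x + τ / 2)) ∈ thetaFour τ := by
  obtain ⟨hd, h₁, h₂⟩ := hu
  refine ⟨by fun_prop, fun x => ?_, fun x => ?_⟩
  · simp only
    rw [show x + 2 + τ / 2 = x + τ / 2 + 2 by ring, h₁,
      exp_eq_exp (b := Real.pi * I * (τ / 4 + x)) (by ring)]
  · simp only
    rw [show x + 2 * τ + τ / 2 = x + τ / 2 + 2 * τ by ring, h₂, ← mul_assoc, ← mul_assoc,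
      ← Complex.exp_add, ← Complex.exp_add]
    ring_nf

/-- The theta function with characteristic `(0, 0)`. -/
noncomputable def theta00 (τ x : ℂ) : ℂ := jacobiTheta₂ x τ

/-- The theta function with characteristic `(0, 1/2)`. -/
noncomputable def theta01 (τ x : ℂ) : ℂ := jacobiTheta₂ (x + 1 / 2) τ

/-- The theta function with characteristic `(1/2, 0)`. -/
noncomputable def theta10 (τ x : ℂ) : ℂ :=
  cexp (Real.pi * I * (τ / 4 + x)) * jacobiTheta₂ (x + τ / 2) τ

/-- The theta function with characteristic `(1/2, 1/2)`. -/
noncomputable def theta11 (τ x : ℂ) : ℂ :=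
  cexp (Real.pi * I * (τ / 4 + x)) * jacobiTheta₂ (x + τ / 2 + 1 / 2) τ

lemma theta00_mem {τ : ℂ} (hτ : 0 < τ.im) : theta00 τ ∈ thetaFour τ := jacobiTheta₂_mem_thetaFour hτ

lemma theta01_mem {τ : ℂ} (hτ : 0 < τ.im) : theta01 τ ∈ thetaFour τ :=
  comp_add_half_mem_thetaFour (jacobiTheta₂_mem_thetaFour hτ)

lemma theta10_mem {τ : ℂ} (hτ : 0 < τ.im) : theta10 τ ∈ thetaFour τ :=
  exp_mul_comp_add_half_tau_mem_thetaFour (jacobiTheta₂_mem_thetaFour hτ)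

lemma theta11_mem {τ : ℂ} (hτ : 0 < τ.im) : theta11 τ ∈ thetaFour τ :=
  exp_mul_comp_add_half_tau_mem_thetaFour (theta01_mem hτ)

/-! ### Addition formulas for the four characteristics, obtained from the first by half-period
translation in `x`. -/

lemma theta00_add_mul_sub {τ : ℂ} (hτ : 0 < τ.im) (x y : ℂ) :
    theta00 τ (x + y) * theta00 τ (x - y) =
    evenTheta τ x * evenTheta τ y + oddTheta τ x * oddTheta τ y :=
  jacobiTheta₂_add_mul_sub hτ x y

lemma theta01_add_mul_sub {τ : ℂ} (hτ : 0 < τ.im) (x y : ℂ) :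
    theta01 τ (x + y) * theta01 τ (x - y) =
    evenTheta τ x * evenTheta τ y - oddTheta τ x * oddTheta τ y := by
  have := jacobiTheta₂_add_mul_sub hτ (x + 1 / 2) y
  rw [evenTheta_add_half, oddTheta_add_half] at this
  unfold theta01
  rw [show x + y + 1 / 2 = x + 1 / 2 + y by ring, show x - y + 1 / 2 = x + 1 / 2 - y by ring, this]
  ring

lemma theta10_add_mul_sub {τ : ℂ} (hτ : 0 < τ.im) (x y : ℂ) :
    theta10 τ (x + y) * theta10 τ (x - y) =
    oddTheta τ x * evenTheta τ y + evenTheta τ x * oddTheta τ y := by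
  have := jacobiTheta₂_add_mul_sub hτ (x + τ / 2) y
  rw [← evenTheta_add_half_tau τ x, ← oddTheta_add_half_tau τ x]
  unfold theta10
  rw [show x + y + τ / 2 = x + τ / 2 + y by ring, show x - y + τ / 2 = x + τ / 2 - y by ring,
    mul_mul_mul_comm, this, ← Complex.exp_add]
  ring_nf

lemma theta11_add_mul_sub {τ : ℂ} (hτ : 0 < τ.im) (x y : ℂ) :
    theta11 τ (x + y) * theta11 τ (x - y) =
    oddTheta τ x * evenTheta τ y - evenTheta τ x * oddTheta τ y := by
  have := jacobiTheta₂_add_mul_sub hτ (x + τ / 2 + 1 / 2) y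
  rw [evenTheta_add_half, oddTheta_add_half] at this
  rw [← evenTheta_add_half_tau τ x, ← oddTheta_add_half_tau τ x]
  unfold theta11
  rw [show x + y + τ / 2 + 1 / 2 = x + τ / 2 + 1 / 2 + y by ring,
    show x - y + τ / 2 + 1 / 2 = x + τ / 2 + 1 / 2 - y by ring,
    mul_mul_mul_comm, this, ← Complex.exp_add]
  ring_nf

lemma exists_theta11_ne_zero {τ : ℂ} (hτ : 0 < τ.im) : ∃ z, theta11 τ z ≠ 0 := by
  obtain ⟨z, hz⟩ := exists_jacobiTheta₂_ne_zero hτ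
  refine ⟨z - τ / 2 - 1 / 2, mul_ne_zero (Complex.exp_ne_zero _) ?_⟩
  convert hz using 2; ring

lemma theta_eq (τ z : ℂ) : theta τ z = -I * theta11 τ z := by
  unfold theta theta11 jacobiTheta₂
  rw [neg_mul, ← mul_neg]
  congr 1
  rw [← tsum_mul_left, ← tsum_neg, ← (Equiv.addRight (1 : ℤ)).tsum_eq]
  refine tsum_congr fun n => ?_
  have h : ((-1 : ℂ) ^ (n + 1)) = -cexp (n * (Real.pi * I)) := by
    rw [Complex.exp_int_mul, exp_pi_mul_I, zpow_add₀ (by norm_num)]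
    simp
  simp only [Equiv.coe_addRight, h, jacobiTheta₂_term, neg_mul, ← Complex.exp_add]
  congr 2
  push_cast; ring

lemma eventually_ne_zero_of_entire {u : ℂ → ℂ} (hu : Differentiable ℂ u) {z : ℂ} (hz : u z ≠ 0)
    (w : ℂ) : ∀ᶠ x in 𝓝[≠] w, u x ≠ 0 := by
  rcases (hu.analyticAt w).eventually_eq_zero_or_eventually_ne_zero with h | h
  · exfalso
    have han : AnalyticOnNhd ℂ u Set.univ := fun z _ => hu.analyticAt z
    exact hz (congrFun (han.eq_of_eventuallyEq (fun z _ => analyticAt_const) h) z)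
  · exact h

/-- A common zero `y` would make `jacobiTheta₂ (x + y) τ * jacobiTheta₂ (x - y) τ` vanish for all
`x`, although neither factor is identically zero. -/
lemma evenTheta_ne_zero_or_oddTheta_ne_zero {τ : ℂ} (hτ : 0 < τ.im) (y : ℂ) :
    evenTheta τ y ≠ 0 ∨ oddTheta τ y ≠ 0 := by
  by_contra! h
  obtain ⟨z, hz⟩ := exists_jacobiTheta₂_ne_zero hτ
  have hd := differentiable_jacobiTheta₂ hτ
  have h₁ := eventually_ne_zero_of_entire (u := fun x => jacobiTheta₂ (x + y) τ)
    (hd.comp (by fun_prop : Differentiable ℂ fun x : ℂ => x + y)) (z := z - y) (by simpa) 0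
  have h₂ := eventually_ne_zero_of_entire (u := fun x => jacobiTheta₂ (x - y) τ)
    (hd.comp (by fun_prop : Differentiable ℂ fun x : ℂ => x - y)) (z := z + y) (by simpa) 0
  obtain ⟨x, hx₁, hx₂⟩ := (h₁.and h₂).exists
  refine mul_ne_zero hx₁ hx₂ ?_
  rw [jacobiTheta₂_add_mul_sub hτ, h.1, h.2, mul_zero, mul_zero, add_zero]

end SklyaninOps

namespace SklyaninOps

/-! ### Products of theta functions -/

/-- Entire functions with the quasi-periodicity of a theta function of degree two. -/
noncomputable def degreeTwo (τ : ℂ) : Submodule ℂ (ℂ → ℂ) where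
  carrier := {u | Differentiable ℂ u ∧ (∀ x, u (x + 1) = u x) ∧
    ∀ x, cexp (2 * Real.pi * I * τ + 4 * Real.pi * I * x) * u (x + τ) = u x}
  zero_mem' := ⟨differentiable_const 0, by simp, by simp⟩
  add_mem' := by
    rintro u v ⟨hu, hu₁, hu₂⟩ ⟨hv, hv₁, hv₂⟩
    refine ⟨hu.add hv, fun x => ?_, fun x => ?_⟩
    · simp [hu₁, hv₁]
    · rw [Pi.add_apply, Pi.add_apply, mul_add, hu₂, hv₂]
  smul_mem' := by
    rintro c u ⟨hu, hu₁, hu₂⟩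
    refine ⟨hu.const_smul c, fun x => ?_, fun x => ?_⟩
    · simp [hu₁]
    · rw [Pi.smul_apply, Pi.smul_apply, mul_smul_comm, hu₂]

lemma evenTheta_mem_degreeTwo {τ : ℂ} (hτ : 0 < τ.im) : evenTheta τ ∈ degreeTwo τ :=
  ⟨differentiable_evenTheta hτ, evenTheta_add_one τ, evenTheta_add_tau τ⟩

lemma oddTheta_mem_degreeTwo {τ : ℂ} (hτ : 0 < τ.im) : oddTheta τ ∈ degreeTwo τ :=
  ⟨differentiable_oddTheta hτ, oddTheta_add_one τ, oddTheta_add_tau τ⟩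

/-- The `n`-th Fourier coefficient. -/
noncomputable def fourierInt (n : ℤ) (u : ℂ → ℂ) : ℂ :=
  ∫ x in (0 : ℝ)..1, cexp (-(2 * Real.pi * I * n * x)) * u x

/-- Moving the contour by `τ` and using quasi-periodicity links coefficients two apart. Coefficients
0 and 1 therefore determine `u`, which bounds the dimension of `degreeTwo τ` by two. -/
lemma fourierInt_add_two {τ : ℂ} {u : ℂ → ℂ} (hu : u ∈ degreeTwo τ) (n : ℤ) :
    fourierInt (n + 2) u = cexp (2 * Real.pi * I * (n + 1) * τ) * fourierInt n u := by
  obtain ⟨hd, h₁, h₂⟩ := hu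
  have key := integral_add_eq_of_periodic
    (H := fun x => cexp (-(2 * Real.pi * I * n * x)) * u x) (by fun_prop) (fun z => by
      rw [h₁, show -(2 * Real.pi * I * n * (z + 1)) =
        -(2 * Real.pi * I * n * z) + (-n : ℤ) * (2 * Real.pi * I) by push_cast; ring,
        Complex.exp_add, exp_int_mul_two_pi_mul_I, mul_one]) τ
  unfold fourierInt
  rw [← key, ← intervalIntegral.integral_const_mul]
  refine intervalIntegral.integral_congr fun x _ => ?_
  rw [← h₂ x, ← mul_assoc, ← mul_assoc, ← Complex.exp_add, ← Complex.exp_add]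
  congr 2
  push_cast; ring

lemma eq_zero_of_fourierInt_eq_zero {τ : ℂ} {u : ℂ → ℂ} (hu : u ∈ degreeTwo τ)
    (h0 : fourierInt 0 u = 0) (h1 : fourierInt 1 u = 0) : u = 0 := by
  have hstep : ∀ n : ℤ, fourierInt (n + 2) u = 0 ↔ fourierInt n u = 0 := fun n => by
    rw [fourierInt_add_two hu, mul_eq_zero, or_iff_right (Complex.exp_ne_zero _)]
  have hall : ∀ k : ℤ, fourierInt (2 * k) u = 0 ∧ fourierInt (2 * k + 1) u = 0 := fun k => by
    induction k using Int.induction_on with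
    | zero => simpa using ⟨h0, h1⟩
    | succ k ih =>
      rw [show 2 * ((k : ℤ) + 1) = 2 * k + 2 by ring,
        show 2 * (k : ℤ) + 2 + 1 = 2 * k + 1 + 2 by ring, hstep, hstep]
      exact ih
    | pred k ih =>
      rw [← hstep, ← hstep (2 * (-(k : ℤ) - 1) + 1), show 2 * (-(k : ℤ) - 1) + 2 = 2 * -k by ring,
        show 2 * (-(k : ℤ) - 1) + 1 + 2 = 2 * -k + 1 by ring]
      exact ih
  refine eq_zero_of_fourier_eq_zero hu.1 hu.2.1 fun n => ?_
  rcases Int.even_or_odd' n with ⟨k, rfl | rfl⟩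
  · exact (hall k).1
  · exact (hall k).2

lemma fourierInt_add {u v : ℂ → ℂ} (hu : Differentiable ℂ u) (hv : Differentiable ℂ v) (n : ℤ) :
    fourierInt n (u + v) = fourierInt n u + fourierInt n v := by
  have hu' := hu.continuous
  have hv' := hv.continuous
  unfold fourierInt
  rw [← intervalIntegral.integral_add]
  · simp only [Pi.add_apply, mul_add]
  · exact Continuous.intervalIntegrable (by fun_prop) _ _
  · exact Continuous.intervalIntegrable (by fun_prop) _ _

lemma fourierInt_smul (c : ℂ) (u : ℂ → ℂ) (n : ℤ) :
    fourierInt n (c • u) = c * fourierInt n u := by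
  unfold fourierInt
  rw [← intervalIntegral.integral_const_mul]
  simp only [Pi.smul_apply, smul_eq_mul, mul_left_comm]

/-- The 2×2 determinant of values at `z` and `0` is, up to sign, `theta11 τ z ^ 2`. -/
lemma evenTheta_oddTheta_independent {τ : ℂ} (hτ : 0 < τ.im) {a b : ℂ}
    (h : a • evenTheta τ + b • oddTheta τ = 0) : a = 0 ∧ b = 0 := by
  obtain ⟨z, hz⟩ := exists_theta11_ne_zero hτ
  have hne := mul_ne_zero hz hz
  have h₁ := theta11_add_mul_sub hτ z 0
  rw [add_zero, sub_zero] at h₁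
  rw [h₁] at hne
  have e₁ : a * evenTheta τ z + b * oddTheta τ z = 0 := congrFun h z
  have e₂ : a * evenTheta τ 0 + b * oddTheta τ 0 = 0 := congrFun h 0
  constructor
  · refine (mul_eq_zero.mp ?_).resolve_right hne
    linear_combination oddTheta τ z * e₂ - oddTheta τ 0 * e₁
  · refine (mul_eq_zero.mp ?_).resolve_right hne
    linear_combination evenTheta τ 0 * e₁ - evenTheta τ z * e₂

lemma exists_eq_of_mem_degreeTwo {τ : ℂ} (hτ : 0 < τ.im) {u : ℂ → ℂ} (hu : u ∈ degreeTwo τ) :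
    ∃ a b : ℂ, u = a • evenTheta τ + b • oddTheta τ := by
  let L : degreeTwo τ →ₗ[ℂ] ℂ × ℂ :=
    { toFun := fun v => (fourierInt 0 v, fourierInt 1 v)
      map_add' := fun v w => by
        ext <;> simp [fourierInt_add v.2.1 w.2.1]
      map_smul' := fun c v => by
        ext <;> simp [fourierInt_smul] }
  have hL : Function.Injective L := by
    rw [← LinearMap.ker_eq_bot, LinearMap.ker_eq_bot']
    intro v hv
    exact Subtype.ext (eq_zero_of_fourierInt_eq_zero v.2 (congrArg Prod.fst hv)
      (congrArg Prod.snd hv))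
  have : FiniteDimensional ℂ (degreeTwo τ) := FiniteDimensional.of_injective L hL
  have hrank : Module.finrank ℂ (degreeTwo τ) ≤ 2 := by
    simpa using LinearMap.finrank_le_finrank_of_injective hL
  let b : Fin 2 → degreeTwo τ :=
    ![⟨evenTheta τ, evenTheta_mem_degreeTwo hτ⟩, ⟨oddTheta τ, oddTheta_mem_degreeTwo hτ⟩]
  have hb : LinearIndependent ℂ b := by
    rw [LinearIndependent.pair_iff]
    intro s t hst
    exact evenTheta_oddTheta_independent hτ (congrArg Subtype.val hst)
  have hcard : Fintype.card (Fin 2) = Module.finrank ℂ (degreeTwo τ) :=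
    le_antisymm hb.fintype_card_le_finrank (by simpa using hrank)
  have htop := hb.span_eq_top_of_card_eq_finrank' hcard
  have hmem : (⟨u, hu⟩ : degreeTwo τ) ∈ Submodule.span ℂ (Set.range b) := htop ▸ Submodule.mem_top
  rw [Matrix.range_cons, Matrix.range_cons, Matrix.range_empty, Set.union_empty,
    Set.singleton_union, Submodule.mem_span_pair] at hmem
  obtain ⟨s, t, hst⟩ := hmem
  exact ⟨s, t, (congrArg Subtype.val hst).symm⟩

/-- The span of the products `u(x + t) v(x - t)`. -/
noncomputable def shiftedProducts (τ t : ℂ) : Submodule ℂ (ℂ → ℂ) :=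
  Submodule.span ℂ {H | ∃ u ∈ thetaFour τ, ∃ v ∈ thetaFour τ, H = fun x => u (x + t) * v (x - t)}

lemma mul_mem_shiftedProducts {τ t : ℂ} {u v : ℂ → ℂ} (hu : u ∈ thetaFour τ)
    (hv : v ∈ thetaFour τ) : (fun x => u (x + t) * v (x - t)) ∈ shiftedProducts τ t :=
  Submodule.subset_span ⟨u, hu, v, hv, rfl⟩

/-- Sums and differences of the four addition formulas at `y = t` isolate each basis function times
`2 * evenTheta τ t` or `2 * oddTheta τ t`; one of these is invertible. -/
lemma degreeTwo_le_shiftedProducts {τ : ℂ} (hτ : 0 < τ.im) (t : ℂ) :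
    degreeTwo τ ≤ shiftedProducts τ t := by
  have m₀ := mul_mem_shiftedProducts (t := t) (theta00_mem hτ) (theta00_mem hτ)
  have m₁ := mul_mem_shiftedProducts (t := t) (theta01_mem hτ) (theta01_mem hτ)
  have m₂ := mul_mem_shiftedProducts (t := t) (theta10_mem hτ) (theta10_mem hτ)
  have m₃ := mul_mem_shiftedProducts (t := t) (theta11_mem hτ) (theta11_mem hτ)
  simp only [theta00_add_mul_sub hτ] at m₀
  simp only [theta01_add_mul_sub hτ] at m₁
  simp only [theta10_add_mul_sub hτ] at m₂
  simp only [theta11_add_mul_sub hτ] at m₃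
  have key : evenTheta τ ∈ shiftedProducts τ t ∧ oddTheta τ ∈ shiftedProducts τ t := by
    rcases evenTheta_ne_zero_or_oddTheta_ne_zero hτ t with h | h
    · constructor
      · convert Submodule.smul_mem _ (2 * evenTheta τ t)⁻¹ (Submodule.add_mem _ m₀ m₁) using 1
        ext x; simp only [Pi.smul_apply, Pi.add_apply, smul_eq_mul]; field_simp; ring
      · convert Submodule.smul_mem _ (2 * evenTheta τ t)⁻¹ (Submodule.add_mem _ m₂ m₃) using 1
        ext x; simp only [Pi.smul_apply, Pi.add_apply, smul_eq_mul]; field_simp; ring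
    · constructor
      · convert Submodule.smul_mem _ (2 * oddTheta τ t)⁻¹ (Submodule.sub_mem _ m₂ m₃) using 1
        ext x; simp only [Pi.smul_apply, Pi.sub_apply, smul_eq_mul]; field_simp; ring
      · convert Submodule.smul_mem _ (2 * oddTheta τ t)⁻¹ (Submodule.sub_mem _ m₀ m₁) using 1
        ext x; simp only [Pi.smul_apply, Pi.sub_apply, smul_eq_mul]; field_simp; ring
  intro u hu
  obtain ⟨a, b, rfl⟩ := exists_eq_of_mem_degreeTwo hτ hu
  exact Submodule.add_mem _ (Submodule.smul_mem _ _ key.1) (Submodule.smul_mem _ _ key.2)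

/-- Changing `t` by the same quarter period leaves the argument of `u` alone and moves that of `v`
by a half period, which preserves `thetaFour τ`. -/
lemma comp_add_quarter_mem_shiftedProducts {τ t : ℂ} {H : ℂ → ℂ}
    (hH : H ∈ shiftedProducts τ (t - 1 / 4)) :
    (fun x => H (x + 1 / 4)) ∈ shiftedProducts τ t := by
  induction hH using Submodule.span_induction with
  | mem H hH =>
    obtain ⟨u, hu, v, hv, rfl⟩ := hH
    convert mul_mem_shiftedProducts (t := t) hu (comp_add_half_mem_thetaFour hv) using 1
    ext x
    simp only
    congr 2 <;> ring
  | zero => exact Submodule.zero_mem _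
  | add f g _ _ hf hg => exact Submodule.add_mem _ hf hg
  | smul c f _ hf => exact Submodule.smul_mem _ c hf

lemma exp_mul_comp_add_quarter_tau_mem_shiftedProducts {τ t : ℂ} {H : ℂ → ℂ}
    (hH : H ∈ shiftedProducts τ (t - τ / 4)) :
    (fun x => cexp (Real.pi * I * x) * H (x + τ / 4)) ∈ shiftedProducts τ t := by
  induction hH using Submodule.span_induction with
  | mem H hH =>
    obtain ⟨u, hu, v, hv, rfl⟩ := hH
    convert Submodule.smul_mem _ (cexp (-(Real.pi * I * (τ / 4 - t))))
      (mul_mem_shiftedProducts (t := t) hu (exp_mul_comp_add_half_tau_mem_thetaFour hv)) using 1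
    ext x
    simp only [Pi.smul_apply, smul_eq_mul]
    rw [show cexp (Real.pi * I * x) = cexp (-(Real.pi * I * (τ / 4 - t))) *
      cexp (Real.pi * I * (τ / 4 + (x - t))) by rw [← Complex.exp_add]; ring_nf,
      show x + τ / 4 + (t - τ / 4) = x + t by ring,
      show x + τ / 4 - (t - τ / 4) = x - t + τ / 2 by ring]
    ring
  | zero =>
    convert Submodule.zero_mem _ using 1
    ext x; simp
  | add f g _ _ hf hg =>
    convert Submodule.add_mem _ hf hg using 1
    ext x; simp [mul_add]
  | smul c f _ hf =>
    convert Submodule.smul_mem _ c hf using 1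
    ext x; simp [mul_left_comm]

lemma mem_shiftedProducts_of_signs {τ : ℂ} (hτ : 0 < τ.im) {H : ℂ → ℂ} (hd : Differentiable ℂ H)
    {ε δ : ℂ} (hε : ε = 1 ∨ ε = -1) (hδ : δ = 1 ∨ δ = -1) (h₁ : ∀ x, H (x + 1) = ε * H x)
    (h₂ : ∀ x, cexp (2 * Real.pi * I * τ + 4 * Real.pi * I * x) * H (x + τ) = δ * H x) (t : ℂ) :
    H ∈ shiftedProducts τ t := by
  have base : ∀ {G : ℂ → ℂ}, Differentiable ℂ G → (∀ x, G (x + 1) = ε * G x) →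
      (∀ x, cexp (2 * Real.pi * I * τ + 4 * Real.pi * I * x) * G (x + τ) = G x) →
      ∀ t, G ∈ shiftedProducts τ t := by
    intro G hG hG₁ hG₂ t
    rcases hε with rfl | rfl
    · exact degreeTwo_le_shiftedProducts hτ t ⟨hG, by simpa using hG₁, hG₂⟩
    -- The exponential changes sign under `x ↦ x + 1`, absorbing `ε = -1`; the translation by `τ /
    -- 4` compensates its effect on the `τ`-multiplier.
    · have hm : (fun x => cexp (-(Real.pi * I * (x - τ / 4))) * G (x - τ / 4)) ∈
          degreeTwo τ := by
        refine ⟨by fun_prop, fun x => ?_, fun x => ?_⟩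
        · simp only
          rw [show x + 1 - τ / 4 = x - τ / 4 + 1 by ring, hG₁,
            ← neg_eq_iff_eq_neg.mpr (exp_eq_neg_exp (a := -(Real.pi * I * (x - τ / 4)))
              (b := -(Real.pi * I * (x - τ / 4 + 1))) (by ring))]
          ring
        · simp only
          rw [← hG₂ (x - τ / 4), ← mul_assoc, ← mul_assoc, ← Complex.exp_add, ← Complex.exp_add]
          ring_nf
      convert exp_mul_comp_add_quarter_tau_mem_shiftedProducts
        (degreeTwo_le_shiftedProducts hτ (t - τ / 4) hm) using 1
      ext x
      rw [← mul_assoc, ← Complex.exp_add]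
      ring_nf
      simp
  rcases hδ with rfl | rfl
  · exact base hd h₁ (by simpa using h₂) t
  -- Translation by `1 / 4` multiplies the factor `exp(4πi x)` by `-1`, absorbing `δ = -1`.
  · have hm := base (G := fun x => H (x - 1 / 4)) (by fun_prop) (fun x => by
      rw [← h₁]; congr 1; ring) (fun x => by
      have := h₂ (x - 1 / 4)
      rw [exp_eq_neg_exp (a := 2 * Real.pi * I * τ + 4 * Real.pi * I * x)
        (b := 2 * Real.pi * I * τ + 4 * Real.pi * I * (x - 1 / 4)) (by ring),
        show x + τ - 1 / 4 = x - 1 / 4 + τ by ring]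
      linear_combination -this) (t - 1 / 4)
    simpa using comp_add_quarter_mem_shiftedProducts hm

lemma mem_shiftedProducts {τ : ℂ} (hτ : 0 < τ.im) {H : ℂ → ℂ} (hd : Differentiable ℂ H)
    (h₁ : ∀ x, H (x + 2) = H x)
    (h₂ : ∀ x, H (x + 2 * τ) = cexp (-(8 * Real.pi * I * (x + τ))) * H x) (t : ℂ) :
    H ∈ shiftedProducts τ t := by
  set r : ℂ → ℂ := fun x => cexp (2 * Real.pi * I * τ + 4 * Real.pi * I * x) with hr
  have hr₁ : ∀ x, r (x + 1) = r x := fun x => by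
    simp only [hr]
    rw [show 2 * Real.pi * I * τ + 4 * Real.pi * I * (x + 1) = 2 * Real.pi * I * τ +
      4 * Real.pi * I * x + 2 * Real.pi * I + 2 * Real.pi * I by ring, exp_eq_exp rfl,
      exp_eq_exp rfl]
  have hr₂ : ∀ x, r x * r (x + τ) * H (x + 2 * τ) = H x := fun x => by
    simp only [hr]
    rw [h₂, ← mul_assoc, ← Complex.exp_add, ← Complex.exp_add]
    ring_nf
    simp
  -- Four times the projection of `H` to the `(ε, δ)` eigenspace of `H ↦ H(x + 1)` and `H ↦ r(x) H(x
  -- + τ)`; `hr₂` says that the latter squares to the identity on `H`. Summed over the signs, these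
  -- give `4 H`.
  have comp : ∀ ε δ : ℂ, (ε = 1 ∨ ε = -1) → (δ = 1 ∨ δ = -1) →
      (fun x => H x + ε * H (x + 1) + δ * (r x * (H (x + τ) + ε * H (x + 1 + τ)))) ∈
        shiftedProducts τ t := by
    intro ε δ hε hδ
    have hε2 : ε * ε = 1 := by rcases hε with rfl | rfl <;> norm_num
    have hδ2 : δ * δ = 1 := by rcases hδ with rfl | rfl <;> norm_num
    refine mem_shiftedProducts_of_signs hτ (by fun_prop) hε hδ (fun x => ?_) (fun x => ?_) t
    · rw [hr₁, show x + 1 + 1 = x + 2 by ring, show x + 2 + τ = x + τ + 2 by ring, h₁, h₁]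
      linear_combination (-H (x + 1) - δ * r x * H (x + 1 + τ)) * hε2
    · change r x * _ = _
      have e₁ := hr₂ x
      have e₂ := hr₂ (x + 1)
      rw [show x + 1 + τ = x + τ + 1 by ring, hr₁, hr₁] at e₂
      rw [show x + τ + 1 + τ = x + 1 + 2 * τ by ring, show x + τ + τ = x + 2 * τ by ring,
        show x + 1 + τ = x + τ + 1 by ring]
      linear_combination δ * e₁ + δ * ε * e₂ -
        r x * (H (x + τ) + ε * H (x + τ + 1)) * hδ2
  have hsum := Submodule.add_mem _
    (Submodule.add_mem _ (comp 1 1 (by simp) (by simp)) (comp 1 (-1) (by simp) (by simp)))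
    (Submodule.add_mem _ (comp (-1) 1 (by simp) (by simp)) (comp (-1) (-1) (by simp) (by simp)))
  convert Submodule.smul_mem _ (1 / 4 : ℂ) hsum using 1
  ext x
  simp only [Pi.smul_apply, Pi.add_apply, smul_eq_mul]
  ring

end SklyaninOps

namespace SklyaninOps

/-! ### Substitutions on meromorphic functions -/

lemma affineSubst_mul (ε s : ℂ) (hε : ε ≠ 0) (f g : Mer) :
    affineSubst ε s hε (f * g) = affineSubst ε s hε f * affineSubst ε s hε g := by
  obtain ⟨_, f, hf, rfl⟩ := f
  obtain ⟨_, g, hg, rfl⟩ := g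
  rfl

lemma affineSubst_affineSubst (ε s δ t : ℂ) (hε : ε ≠ 0) (hδ : δ ≠ 0) (f : Mer) :
    affineSubst ε s hε (affineSubst δ t hδ f) =
      affineSubst (δ * ε) (δ * s + t) (mul_ne_zero hδ hε) f := by
  obtain ⟨_, f, hf, rfl⟩ := f
  refine Subtype.ext ?_
  change ((f ∘ fun z => δ * z + t) ∘ fun z => ε * z + s : Germ (codiscrete ℂ) ℂ) =
    (f ∘ fun z => δ * ε * z + (δ * s + t) : ℂ → ℂ)
  congr 1
  ext z
  simp only [Function.comp]
  congr 1; ring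

lemma affineSubst_one_zero (f : Mer) : affineSubst 1 0 one_ne_zero f = f := by
  obtain ⟨_, f, hf, rfl⟩ := f
  refine Subtype.ext ?_
  change ((f ∘ fun z => 1 * z + 0 : ℂ → ℂ) : Germ (codiscrete ℂ) ℂ) = (f : Germ (codiscrete ℂ) ℂ)
  congr 1
  ext z
  simp

lemma affineSubst_congr {ε s δ t : ℂ} (hε : ε ≠ 0) (hδ : δ ≠ 0) (h₁ : ε = δ) (h₂ : s = t)
    (f : Mer) : affineSubst ε s hε f = affineSubst δ t hδ f := by
  subst h₁ h₂; rfl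

lemma reflect_one : reflect 1 = 1 := rfl

lemma shift_mul (s : ℂ) (f g : Mer) : shift s (f * g) = shift s f * shift s g :=
  affineSubst_mul ..

lemma reflect_mul (f g : Mer) : reflect (f * g) = reflect f * reflect g :=
  affineSubst_mul ..

lemma shift_shift (s t : ℂ) (f : Mer) : shift s (shift t f) = shift (s + t) f := by
  refine (affineSubst_affineSubst ..).trans (affineSubst_congr _ _ ?_ ?_ f) <;> ring

lemma shift_zero (f : Mer) : shift 0 f = f := affineSubst_one_zero f

lemma reflect_reflect (f : Mer) : reflect (reflect f) = f :=
  (affineSubst_affineSubst ..).trans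
    ((affineSubst_congr _ _ (by ring) (by ring) f).trans (affineSubst_one_zero f))

lemma reflect_shift (s : ℂ) (f : Mer) : reflect (shift s f) = shift (-s) (reflect f) := by
  refine (affineSubst_affineSubst ..).trans (Eq.trans ?_ (affineSubst_affineSubst ..).symm)
  refine affineSubst_congr _ _ ?_ ?_ f <;> ring

/-! ### Products of two generators -/

lemma genOp_mul_genOp (η : ℂ) (f g : Mer) :
    genOp η f * genOp η g = mulOp (f * shift η g) * shift (2 * η) +
      mulOp (f * shift η (reflect g) + reflect f * shift (-η) g) +
      mulOp (reflect (f * shift η g)) * shift (-(2 * η)) := by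
  refine LinearMap.ext fun F => ?_
  simp only [genOp, mulOp, Module.End.mul_apply, LinearMap.add_apply, LinearMap.mulLeft_apply,
    shift_mul, reflect_mul, reflect_shift, map_add, shift_shift]
  rw [show η + η = 2 * η by ring, show η + -η = 0 by ring, show -η + η = 0 by ring,
    show -η + -η = -(2 * η) by ring, shift_zero]
  ring

lemma shift_neg_eq_of_shift_eq_smul {s a : ℂ} (ha : a ≠ 0) {g : Mer} (h : shift s g = a • g) :
    shift (-s) g = a⁻¹ • g := by
  have h' := congrArg (shift (-s)) h
  rw [shift_shift, neg_add_cancel, shift_zero, map_smul] at h'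
  rw [eq_inv_smul_iff₀ ha]
  exact h'.symm

/-- Reflection inverts the multiplier, so `μ` and `μ⁻¹` cancel in each product; reflection exchanges
the two summands. -/
lemma constantTerm_elliptic {τ η μ : ℂ} (hμ : μ ≠ 0) {f g : Mer} (hf : f ∈ coeffSpace τ η μ 1)
    (hg : g ∈ coeffSpace τ η μ 1) :
    let c₀ := f * shift η (reflect g) + reflect f * shift (-η) g
    shift 1 c₀ = c₀ ∧ shift τ c₀ = c₀ ∧ reflect c₀ = c₀ := by
  have one (k : Mer) (hk : shift 1 k = k) : shift 1 (reflect k) = reflect k := by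
    have := shift_neg_eq_of_shift_eq_smul (s := 1) one_ne_zero (hk.trans (one_smul ℂ k).symm)
    rw [inv_one, one_smul] at this
    conv_rhs => rw [← this]
    rw [reflect_shift, neg_neg]
  have tau (k : Mer) (hk : shift τ k = μ ^ 1 • k) : shift τ (reflect k) = μ⁻¹ • reflect k := by
    rw [pow_one] at hk
    rw [← map_smul, ← shift_neg_eq_of_shift_eq_smul hμ hk, reflect_shift, neg_neg]
  have comm (s t : ℂ) (k : Mer) : shift s (shift t k) = shift t (shift s k) := by
    rw [shift_shift, shift_shift, add_comm]
  have cancel (a b : Mer) : (μ • a) * (μ⁻¹ • b) = a * b := by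
    rw [smul_mul_smul_comm, mul_inv_cancel₀ hμ, one_smul]
  have cancel' (a b : Mer) : (μ⁻¹ • a) * (μ • b) = a * b := by
    rw [smul_mul_smul_comm, inv_mul_cancel₀ hμ, one_smul]
  refine ⟨?_, ?_, ?_⟩
  · rw [map_add, shift_mul, shift_mul, comm 1 η, comm 1 (-η), one g hg.1, one f hf.1, hf.1, hg.1]
  · rw [map_add, shift_mul, shift_mul, comm τ η, comm τ (-η), tau g hg.2.1, tau f hf.2.1, hf.2.1,
      hg.2.1, pow_one, map_smul, map_smul, cancel, cancel']
  · rw [map_add, reflect_mul, reflect_mul, reflect_shift, reflect_shift, reflect_reflect,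
      reflect_reflect, neg_neg, add_comm]

lemma exists_operator_of_mem_span {τ η μ : ℂ} (hμ : μ ≠ 0) {c₂ : Mer}
    (hc : c₂ ∈ Submodule.span ℂ {p : Mer | ∃ f ∈ coeffSpace τ η μ 1, ∃ g ∈ coeffSpace τ η μ 1,
        p = f * shift η g}) :
    ∃ c₀ : Mer, shift 1 c₀ = c₀ ∧ shift τ c₀ = c₀ ∧ reflect c₀ = c₀ ∧
      mulOp c₂ * shift (2 * η) + mulOp c₀ + mulOp (reflect c₂) * shift (-(2 * η)) ∈
        twofoldSpan τ η μ := by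
  have mulOp_add (a b : Mer) : mulOp (a + b) = mulOp a + mulOp b :=
    LinearMap.ext fun F => add_mul a b F
  have mulOp_smul (r : ℂ) (a : Mer) : mulOp (r • a) = r • mulOp a :=
    LinearMap.ext fun F => smul_mul_assoc r a F
  have mulOp_zero : mulOp 0 = 0 := LinearMap.ext fun F => zero_mul F
  induction hc using Submodule.span_induction with
  | mem p hp =>
    obtain ⟨f, hf, g, hg, rfl⟩ := hp
    obtain ⟨h₁, h₂, h₃⟩ := constantTerm_elliptic hμ hf hg
    refine ⟨_, h₁, h₂, h₃, ?_⟩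
    rw [← genOp_mul_genOp]
    exact Submodule.subset_span ⟨f, hf, g, hg, rfl⟩
  | zero =>
    refine ⟨0, map_zero _, map_zero _, map_zero _, ?_⟩
    simp [mulOp_zero]
  | add p q _ _ hp hq =>
    obtain ⟨a, ha₁, ha₂, ha₃, ha⟩ := hp
    obtain ⟨b, hb₁, hb₂, hb₃, hb⟩ := hq
    refine ⟨a + b, by rw [map_add, ha₁, hb₁], by rw [map_add, ha₂, hb₂],
      by rw [map_add, ha₃, hb₃], ?_⟩
    convert Submodule.add_mem _ ha hb using 1
    rw [map_add, mulOp_add, mulOp_add, mulOp_add, add_mul, add_mul]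
    abel
  | smul r p _ hp =>
    obtain ⟨a, ha₁, ha₂, ha₃, ha⟩ := hp
    refine ⟨r • a, by rw [map_smul, ha₁], by rw [map_smul, ha₂], by rw [map_smul, ha₃], ?_⟩
    convert Submodule.smul_mem _ r ha using 1
    rw [map_smul, mulOp_smul, mulOp_smul, mulOp_smul, smul_add, smul_add, smul_mul_assoc,
      smul_mul_assoc]

/-! ### Theta quotients -/

lemma eventually_codiscrete_ne_zero {u : ℂ → ℂ} (hu : Differentiable ℂ u) {z : ℂ} (hz : u z ≠ 0) :
    ∀ᶠ x in codiscrete ℂ, u x ≠ 0 := by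
  rw [Filter.Eventually, codiscrete, mem_codiscreteWithin_iff_forall_mem_nhdsNE]
  intro x _
  simpa [Filter.Eventually] using eventually_ne_zero_of_entire hu hz x

lemma eq_of_eventuallyEq_codiscrete {f g : ℂ → ℂ} (hf : Continuous f) (hg : Continuous g)
    (h : f =ᶠ[codiscrete ℂ] g) : f = g := by
  ext x
  have h' : f =ᶠ[𝓝[≠] x] g := by
    rw [Filter.EventuallyEq, Filter.Eventually, codiscrete,
      mem_codiscreteWithin_iff_forall_mem_nhdsNE] at h
    simpa [Filter.EventuallyEq, Filter.Eventually] using h x (Set.mem_univ x)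
  exact tendsto_nhds_unique ((hf.tendsto x).mono_left nhdsWithin_le_nhds |>.congr' h')
    ((hg.tendsto x).mono_left nhdsWithin_le_nhds)

lemma theta_mem {τ : ℂ} (hτ : 0 < τ.im) : theta τ ∈ thetaFour τ := by
  rw [show theta τ = -I • theta11 τ from funext (theta_eq τ)]
  exact Submodule.smul_mem _ _ (theta11_mem hτ)

lemma eventually_theta_ne_zero {τ : ℂ} (hτ : 0 < τ.im) (a : ℂ) :
    ∀ᶠ z in codiscrete ℂ, theta τ (2 * z + a) ≠ 0 := by
  obtain ⟨z, hz⟩ := exists_theta11_ne_zero hτ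
  refine eventually_codiscrete_ne_zero (z := (z - a) / 2)
    ((theta_mem hτ).1.comp (by fun_prop : Differentiable ℂ fun z : ℂ => 2 * z + a)) ?_
  rw [show 2 * ((z - a) / 2) + a = z by ring, theta_eq]
  simpa using hz

/-- The meromorphic function `u(2z - c) / θ(2z)`. -/
noncomputable def thetaQuot {τ : ℂ} (hτ : 0 < τ.im) (c : ℂ) (u : thetaFour τ) : Mer :=
  ⟨((fun z => (u : ℂ → ℂ) (2 * z - c) / theta τ (2 * z) : ℂ → ℂ) : Germ (codiscrete ℂ) ℂ), _, by
    intro z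
    have h₁ : Differentiable ℂ fun z => (u : ℂ → ℂ) (2 * z - c) := u.2.1.comp (by fun_prop)
    have h₂ : Differentiable ℂ fun z => theta τ (2 * z) := (theta_mem hτ).1.comp (by fun_prop)
    exact (h₁.analyticAt z).meromorphicAt.div (h₂.analyticAt z).meromorphicAt, rfl⟩

lemma thetaQuot_mem {τ : ℂ} (hτ : 0 < τ.im) (η c : ℂ) (u : thetaFour τ) :
    thetaQuot hτ c u ∈ coeffSpace τ η (cexp (4 * Real.pi * I * c)) 1 := by
  obtain ⟨u, hu⟩ := u
  have hθ := theta_mem hτ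
  refine ⟨Subtype.ext ?_, Subtype.ext ?_, fun z => u (2 * z - c), ?_, ?_⟩
  · refine congrArg (fun f : ℂ → ℂ => (f : Germ (codiscrete ℂ) ℂ)) (funext fun z => ?_)
    simp only [Function.comp]
    rw [show 2 * (1 * z + 1) - c = 2 * z - c + 2 by ring,
      show 2 * (1 * z + 1) = 2 * z + 2 by ring, hu.2.1, hθ.2.1]
  · refine congrArg (fun f : ℂ → ℂ => (f : Germ (codiscrete ℂ) ℂ)) (funext fun z => ?_)
    simp only [Function.comp]
    change _ = cexp (4 * Real.pi * I * c) ^ 1 * (u (2 * z - c) / theta τ (2 * z))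
    rw [show 2 * (1 * z + τ) - c = 2 * z - c + 2 * τ by ring,
      show 2 * (1 * z + τ) = 2 * z + 2 * τ by ring, hu.2.2, hθ.2.2, mul_div_mul_comm,
      ← Complex.exp_sub, pow_one]
    ring_nf
  · exact hu.1.comp (by fun_prop)
  · refine Germ.coe_eq.mpr ?_
    filter_upwards [eventually_theta_ne_zero hτ 0] with z hz
    rw [add_zero] at hz
    simp [thetaProd, hz]

end SklyaninOps

namespace SklyaninOps

/-! ### The space `V_2` is spanned by products -/

lemma mul_shift_mem_coeffSpace {τ η μ : ℂ} {f g : Mer} (hf : f ∈ coeffSpace τ η μ 1)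
    (hg : g ∈ coeffSpace τ η μ 1) : f * shift η g ∈ coeffSpace τ η μ 2 := by
  obtain ⟨hf₁, hf₂, u, hu, hfu⟩ := hf
  obtain ⟨hg₁, hg₂, v, hv, hgv⟩ := hg
  refine ⟨?_, ?_, fun z => u z * v (z + η), by fun_prop, ?_⟩
  · rw [shift_mul, shift_shift, add_comm 1 η, ← shift_shift, hf₁, hg₁]
  · rw [shift_mul, shift_shift, add_comm τ η, ← shift_shift, hf₂, hg₂, map_smul,
      smul_mul_smul_comm, pow_one, sq]
  · obtain ⟨_, F, hF, rfl⟩ := f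
    obtain ⟨_, G, hG, rfl⟩ := g
    have e₁ : (fun z => F z * thetaProd τ η 1 z) =ᶠ[codiscrete ℂ] u := Germ.coe_eq.mp hfu
    have e₂ : (fun z => G z * thetaProd τ η 1 z) =ᶠ[codiscrete ℂ] v := Germ.coe_eq.mp hgv
    have e₃ := e₂.comp_tendsto (tendsto_affine_codiscrete 1 η one_ne_zero)
    refine Germ.coe_eq.mpr ?_
    filter_upwards [e₁, e₃] with z h₁ h₃
    simp only [Function.comp, thetaProd, Finset.prod_range_one, Nat.cast_zero, mul_zero, zero_mul,
      add_zero, one_mul] at h₁ h₃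
    rw [← h₁, ← h₃]
    change F z * G (1 * z + η) * thetaProd τ η 2 z = _
    simp only [thetaProd, Finset.prod_range_succ, Finset.prod_range_zero, Nat.cast_zero, mul_zero,
      zero_mul, add_zero, one_mul, Nat.cast_one, mul_one, mul_add]
    ring

lemma exists_mem_span_eq_of_mem_shiftedProducts {τ : ℂ} (hτ : 0 < τ.im) (η c : ℂ) {H : ℂ → ℂ}
    (hH : H ∈ shiftedProducts τ η) :
    ∃ p ∈ Submodule.span ℂ {p : Mer | ∃ f ∈ coeffSpace τ η (cexp (4 * Real.pi * I * c)) 1,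
        ∃ g ∈ coeffSpace τ η (cexp (4 * Real.pi * I * c)) 1, p = f * shift η g},
      (p : Germ (codiscrete ℂ) ℂ) =
        ((fun z => H (2 * z - c + η) / (theta τ (2 * z) * theta τ (2 * z + 2 * η)) : ℂ → ℂ) :
          Germ (codiscrete ℂ) ℂ) := by
  induction hH using Submodule.span_induction with
  | mem H hH =>
    obtain ⟨u, hu, v, hv, rfl⟩ := hH
    -- At `x = 2z - c + η` one has `x - η = 2z - c` and `x + η = 2(z + η) - c`: hence `v` gives the
    -- unshifted factor and `u` the shifted one.
    refine ⟨_, Submodule.subset_span ⟨_, thetaQuot_mem hτ η c ⟨v, hv⟩, _,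
      thetaQuot_mem hτ η c ⟨u, hu⟩, rfl⟩, ?_⟩
    refine congrArg (fun f : ℂ → ℂ => (f : Germ (codiscrete ℂ) ℂ)) (funext fun z => ?_)
    change v (2 * z - c) / theta τ (2 * z) *
      (u (2 * (1 * z + η) - c) / theta τ (2 * (1 * z + η))) = _
    rw [show 2 * (1 * z + η) - c = 2 * z - c + η + η by ring,
      show 2 * (1 * z + η) = 2 * z + 2 * η by ring, div_mul_div_comm, mul_comm (v _)]
    simp only [add_sub_cancel_right]
  | zero =>
    refine ⟨0, Submodule.zero_mem _, ?_⟩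
    simp only [Pi.zero_apply, zero_div]
    rfl
  | add f g _ _ hf hg =>
    obtain ⟨p, hp, hp'⟩ := hf
    obtain ⟨q, hq, hq'⟩ := hg
    refine ⟨p + q, Submodule.add_mem _ hp hq, ?_⟩
    rw [Subalgebra.coe_add, hp', hq']
    refine congrArg (fun f : ℂ → ℂ => (f : Germ (codiscrete ℂ) ℂ)) (funext fun z => ?_)
    exact (add_div _ _ _).symm
  | smul r f _ hf =>
    obtain ⟨p, hp, hp'⟩ := hf
    refine ⟨r • p, Submodule.smul_mem _ r hp, ?_⟩
    rw [Subalgebra.coe_smul, hp']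
    refine congrArg (fun f : ℂ → ℂ => (f : Germ (codiscrete ℂ) ℂ)) (funext fun z => ?_)
    exact (mul_div_assoc _ _ _).symm

lemma mem_span_of_mem_coeffSpace_two {τ : ℂ} (hτ : 0 < τ.im) (η c : ℂ) {g : Mer}
    (hg : g ∈ coeffSpace τ η (cexp (4 * Real.pi * I * c)) 2) :
    g ∈ Submodule.span ℂ {p : Mer | ∃ f ∈ coeffSpace τ η (cexp (4 * Real.pi * I * c)) 1,
        ∃ g ∈ coeffSpace τ η (cexp (4 * Real.pi * I * c)) 1, p = f * shift η g} := by
  obtain ⟨hg₁, hg₂, h, hh, hgh⟩ := hg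
  obtain ⟨_, G, hG, rfl⟩ := g
  have hθ := theta_mem hτ
  have hc := hh.continuous
  have e : ∀ᶠ z in codiscrete ℂ, G z * (theta τ (2 * z) * theta τ (2 * z + 2 * η)) = h z := by
    filter_upwards [Germ.coe_eq.mp hgh] with z hz
    rw [← hz]
    simp [thetaProd, Finset.prod_range_succ]
  have e₁ : ∀ᶠ z in codiscrete ℂ, G (1 * z + 1) = G z :=
    Germ.coe_eq.mp (congrArg Subtype.val hg₁)
  have e₂ : ∀ᶠ z in codiscrete ℂ, G (1 * z + τ) = cexp (4 * Real.pi * I * c) ^ 2 * G z :=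
    Germ.coe_eq.mp (congrArg Subtype.val hg₂)
  have h₁ : (fun z => h (z + 1)) = h := by
    refine eq_of_eventuallyEq_codiscrete (by fun_prop) hc ?_
    filter_upwards [e, e₁, (tendsto_affine_codiscrete 1 1 one_ne_zero).eventually e]
      with z hz hz₁ hz₂
    rw [hz₁] at hz₂
    rw [← hz, ← one_mul z, ← hz₂, one_mul, show 2 * (z + 1) = 2 * z + 2 by ring,
      show 2 * z + 2 + 2 * η = 2 * z + 2 * η + 2 by ring, hθ.2.1, hθ.2.1]
  have h₂ : (fun z => h (z + τ)) = fun z =>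
      cexp (-(8 * Real.pi * I * (2 * z - c + η + τ))) * h z := by
    refine eq_of_eventuallyEq_codiscrete (by fun_prop) (by fun_prop) ?_
    filter_upwards [e, e₂, (tendsto_affine_codiscrete 1 τ one_ne_zero).eventually e]
      with z hz hz₁ hz₂
    rw [hz₁] at hz₂
    rw [← hz, ← one_mul z, ← hz₂, one_mul, show 2 * (z + τ) = 2 * z + 2 * τ by ring,
      show 2 * z + 2 * τ + 2 * η = 2 * z + 2 * η + 2 * τ by ring, hθ.2.2, hθ.2.2,
      show cexp (-(8 * Real.pi * I * (2 * z - c + η + τ))) = cexp (4 * Real.pi * I * c) ^ 2 *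
        (cexp (-(4 * Real.pi * I * (2 * z + τ))) *
          cexp (-(4 * Real.pi * I * (2 * z + 2 * η + τ)))) by
        rw [← Complex.exp_nat_mul, ← Complex.exp_add, ← Complex.exp_add]
        congr 1; push_cast; ring]
    ring
  -- Inverting `x = 2z - c + η` removes `c` and `η` from the multiplier found in `h₂`.
  have hH : (fun x => h ((x + c - η) / 2)) ∈ shiftedProducts τ η := by
    refine mem_shiftedProducts hτ (by fun_prop) (fun x => ?_) (fun x => ?_) η
    · rw [show (x + 2 + c - η) / 2 = (x + c - η) / 2 + 1 by ring]
      exact congrFun h₁ _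
    · rw [show (x + 2 * τ + c - η) / 2 = (x + c - η) / 2 + τ by ring]
      refine (congrFun h₂ _).trans ?_
      congr 2; ring
  obtain ⟨p, hp, hp'⟩ := exists_mem_span_eq_of_mem_shiftedProducts hτ η c hH
  convert hp using 1
  refine Subtype.ext (Eq.trans (Germ.coe_eq.mpr ?_) hp'.symm)
  filter_upwards [e, eventually_theta_ne_zero hτ 0, eventually_theta_ne_zero hτ (2 * η)]
    with z hz hz₁ hz₂
  rw [add_zero] at hz₁
  rw [eq_div_iff (mul_ne_zero hz₁ hz₂), hz]
  congr 1; ring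

/-! ### The constants -/

/-- The four theta functions with characteristics. -/
noncomputable def thetaChar {τ : ℂ} (hτ : 0 < τ.im) : Fin 4 → thetaFour τ :=
  ![⟨theta00 τ, theta00_mem hτ⟩, ⟨theta01 τ, theta01_mem hτ⟩, ⟨theta10 τ, theta10_mem hτ⟩,
    ⟨theta11 τ, theta11_mem hτ⟩]

lemma theta11_neg (τ w : ℂ) : theta11 τ (-w) = -theta11 τ w := by
  unfold theta11
  rw [← jacobiTheta₂_neg_left, show -(-w + τ / 2 + 1 / 2) = w - τ / 2 - 1 / 2 by ring,
    show w + τ / 2 + 1 / 2 = w - τ / 2 - 1 / 2 + 1 + τ by ring, jacobiTheta₂_add_left',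
    jacobiTheta₂_add_left, ← mul_assoc, ← Complex.exp_add, ← neg_mul]
  congr 1
  exact exp_eq_neg_exp (by ring)

/-- The `k i` are chosen so that the combination of addition formulas factors as a function of `x`
times `q * evenTheta τ y - p * oddTheta τ y`. The second factor vanishes at `y = η`, and at `y = w +
η` it is a product of two values of `theta11`. -/
lemma exists_coeffs_sum_theta {τ : ℂ} (hτ : 0 < τ.im) (η c : ℂ) : ∃ k : Fin 4 → ℂ,
    (∀ w, ∑ i, k i * ((thetaChar hτ i : ℂ → ℂ) w * (thetaChar hτ i : ℂ → ℂ) (w + 2 * η)) = 0) ∧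
    ∀ w, ∑ i, k i * ((thetaChar hτ i : ℂ → ℂ) (w - c) *
      (thetaChar hτ i : ℂ → ℂ) (-w - 2 * η - c)) = theta τ w * theta τ (-w - 2 * η) := by
  -- The value `-1 / 2` offsets the factor 2 in `expand` and the sign from `θ = -i θ₁₁`.
  obtain ⟨a, b, hab⟩ : ∃ a b : ℂ,
      a * evenTheta τ (-c - η) + b * oddTheta τ (-c - η) = -1 / 2 := by
    rcases evenTheta_ne_zero_or_oddTheta_ne_zero hτ (-c - η) with h | h
    · exact ⟨-(2 * evenTheta τ (-c - η))⁻¹, 0, by field_simp; simp⟩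
    · exact ⟨0, -(2 * oddTheta τ (-c - η))⁻¹, by field_simp; simp⟩
  set p := evenTheta τ η
  set q := oddTheta τ η
  have expand : ∀ x y, (a * q - b * p) * (theta00 τ (x + y) * theta00 τ (x - y)) +
      (a * q + b * p) * (theta01 τ (x + y) * theta01 τ (x - y)) +
      (b * q - a * p) * (theta10 τ (x + y) * theta10 τ (x - y)) +
      (b * q + a * p) * (theta11 τ (x + y) * theta11 τ (x - y)) =
      2 * (a * evenTheta τ x + b * oddTheta τ x) *
        (q * evenTheta τ y - p * oddTheta τ y) := fun x y => by
    rw [theta00_add_mul_sub hτ, theta01_add_mul_sub hτ, theta10_add_mul_sub hτ,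
      theta11_add_mul_sub hτ]
    ring
  refine ⟨![a * q - b * p, a * q + b * p, b * q - a * p, b * q + a * p], fun w => ?_, fun w => ?_⟩
  · have := expand (w + η) η
    rw [add_sub_cancel_right, show w + η + η = w + 2 * η by ring] at this
    simp only [Fin.sum_univ_four, thetaChar, Matrix.cons_val]
    linear_combination this
  · have h₁ := expand (-c - η) (w + η)
    rw [show -c - η + (w + η) = w - c by ring,
      show -c - η - (w + η) = -w - 2 * η - c by ring, hab] at h₁
    have h₂ := theta11_add_mul_sub hτ η (w + η)
    rw [show η + (w + η) = -(-w - 2 * η) by ring, show η - (w + η) = -w by ring, theta11_neg,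
      theta11_neg] at h₂
    simp only [Fin.sum_univ_four, thetaChar, Matrix.cons_val]
    rw [theta_eq, theta_eq]
    linear_combination h₁ + h₂ - theta11 τ w * theta11 τ (-w - 2 * η) * I_sq

lemma smul_one_mem_twofoldSpan {τ : ℂ} (hτ : 0 < τ.im) (η c r : ℂ) :
    r • (1 : Module.End ℂ Mer) ∈ twofoldSpan τ η (cexp (4 * Real.pi * I * c)) := by
  obtain ⟨k, hk₁, hk₂⟩ := exists_coeffs_sum_theta hτ η c
  let f : Fin 4 → Mer := fun i => thetaQuot hτ c (thetaChar hτ i)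
  have hA : ∑ i, k i • (f i * shift η (f i)) = 0 := by
    rw [Fin.sum_univ_four]
    refine Subtype.ext (congrArg (fun f : ℂ → ℂ => (f : Germ (codiscrete ℂ) ℂ))
      (funext fun z => ?_) : _ = ((0 : ℂ → ℂ) : Germ (codiscrete ℂ) ℂ))
    have h := hk₁ (2 * z - c)
    rw [Fin.sum_univ_four, show 2 * z - c + 2 * η = 2 * (1 * z + η) - c by ring] at h
    simp only [Function.comp, smul_eq_mul, div_mul_div_comm]
    simp only [← mul_div_assoc, ← add_div]
    rw [h, zero_div, Pi.zero_apply]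
  have hB : ∑ i, k i • (f i * shift η (reflect (f i))) = 1 := by
    rw [Fin.sum_univ_four]
    refine Subtype.ext (Germ.coe_eq.mpr ?_ : _ = ((1 : ℂ → ℂ) : Germ (codiscrete ℂ) ℂ))
    have hne := (tendsto_affine_codiscrete (-1) (-η) (by norm_num)).eventually
      (eventually_theta_ne_zero hτ 0)
    filter_upwards [eventually_theta_ne_zero hτ 0, hne] with z hz₁ hz₂
    have h := hk₂ (2 * z)
    rw [add_zero] at hz₁
    rw [show 2 * (-1 * z + -η) + 0 = 2 * (-1 * (1 * z + η) + 0) by ring] at hz₂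
    rw [Fin.sum_univ_four, show -(2 * z) - 2 * η = 2 * (-1 * (1 * z + η) + 0) by ring] at h
    simp only [Function.comp, smul_eq_mul, div_mul_div_comm]
    simp only [← mul_div_assoc, ← add_div]
    rw [h, div_self (mul_ne_zero hz₁ hz₂), Pi.one_apply]
  have hA' : ∑ i, k i • reflect (f i * shift η (f i)) = 0 := by
    simpa only [map_sum, map_smul, map_zero] using congrArg reflect hA
  have hB' : ∑ i, k i • (reflect (f i) * shift (-η) (f i)) = 1 := by
    simpa only [map_sum, map_smul, reflect_mul, reflect_shift, reflect_reflect, reflect_one] using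
      congrArg reflect hB
  -- The constant coefficient is `hB` plus its reflection `hB'`, hence `1 + 1`.
  have hsum : ∑ i, k i • (genOp η (f i) * genOp η (f i)) = (2 : ℂ) • 1 := by
    refine LinearMap.ext fun F => ?_
    have e : (∑ i, k i • (genOp η (f i) * genOp η (f i))) F =
        (∑ i, k i • (f i * shift η (f i))) * shift (2 * η) F +
        (∑ i, k i • (f i * shift η (reflect (f i))) +
          ∑ i, k i • (reflect (f i) * shift (-η) (f i))) * F +
        (∑ i, k i • reflect (f i * shift η (f i))) * shift (-(2 * η)) F := by
      simp only [genOp_mul_genOp, LinearMap.sum_apply, LinearMap.smul_apply, LinearMap.add_apply,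
        Module.End.mul_apply, mulOp, LinearMap.mulLeft_apply, Finset.sum_mul, smul_add,
        Finset.sum_add_distrib, add_mul, smul_mul_assoc]
    rw [e, hA, hB, hA', hB', zero_mul, zero_mul, zero_add, add_zero, add_mul, one_mul,
      LinearMap.smul_apply, Module.End.one_apply, two_smul]
  have hr : r • (1 : Module.End ℂ Mer) =
      (r / 2) • ∑ i, k i • (genOp η (f i) * genOp η (f i)) := by
    rw [hsum, smul_smul, div_mul_cancel₀ _ two_ne_zero]
  rw [hr]
  exact Submodule.smul_mem _ _ (Submodule.sum_mem _ fun i _ => Submodule.smul_mem _ _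
    (Submodule.subset_span ⟨_, thetaQuot_mem hτ η c _, _, thetaQuot_mem hτ η c _, rfl⟩))

end SklyaninOps

theorem lemma3p3 (τ : ℂ) (hτ : 0 < τ.im) (μ : ℂ) (hμ : μ ≠ 0) (η : ℂ) (hη : η ≠ 0) :
    (∀ c : ℂ, c • (1 : Module.End ℂ Mer) ∈ twofoldSpan τ η μ) ∧
    (∀ c₂ ∈ coeffSpace τ η μ 2, ∃ c₀ : Mer,
      shift 1 c₀ = c₀ ∧ shift τ c₀ = c₀ ∧ reflect c₀ = c₀ ∧
      mulOp c₂ * shift (2 * η) + mulOp c₀ + mulOp (reflect c₂) * shift (-(2 * η)) ∈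
        twofoldSpan τ η μ) ∧
    coeffSpace τ η μ 2 =
      Submodule.span ℂ {p : Mer | ∃ f ∈ coeffSpace τ η μ 1, ∃ g ∈ coeffSpace τ η μ 1,
        p = f * shift η g} := by
  -- This is the multiplier that `u(2z - c) / θ(2z)` acquires under `z ↦ z + τ`.
  obtain ⟨c, rfl⟩ : ∃ c, cexp (4 * Real.pi * I * c) = μ := by
    refine ⟨log μ / (4 * Real.pi * I), ?_⟩
    rw [mul_div_cancel₀ _ (by simp [Real.pi_ne_zero]), Complex.exp_log hμ]
  refine ⟨smul_one_mem_twofoldSpan hτ η c, fun c₂ hc₂ =>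
    exists_operator_of_mem_span hμ (mem_span_of_mem_coeffSpace_two hτ η c hc₂),
    le_antisymm (fun g hg => mem_span_of_mem_coeffSpace_two hτ η c hg)
      (Submodule.span_le.mpr ?_)⟩
  rintro _ ⟨f, hf, g, hg, rfl⟩
  exact mul_shift_mem_coeffSpace hf hg
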